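/- Let $R=\mathbb{C}[x_0,\dots,x_n]$ and let $X\subset\mathbb{P}^n$ be a projective variety (a Zariski-closed subset, not assumed irreducible) over $\mathbb{C}$ whose homogeneous ideal $I_X\subset R$ is generated by quadrics. Let $F_0\otimes R(-2)\leftarrow F_1\otimes R(-3)\leftarrow\cdots$ be the linear part of the minimal graded free resolution of $I_X$, so that $F_i$ is the complex vector space spanned by the generators of degree $i+2$ of the $i$-th free module ($i\ge 0$); its elements are called $i$-th linear syzygies. For $p\ge 1$ and $f\in F_p$, the rank of $f$ is the dimension of the smallest subspace $G\subset F_{p-1}$ such that the differential maps $f\otimes R(-p-2)$ into $G\otimes R(-p-1)$. If, for some $p\ge 1$, there is a $p$-th linear syzygy $f\in F_p$ of rank $p+1$, then $X$ is either contained in a hyperplane or reducible. -/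

import Mathlib

namespace LinearSyzygies

attribute [local instance] MvPolynomial.gradedAlgebra

/-- The homogeneous coordinate ring `ℂ[x₀, …, xₙ]` of `ℙⁿ`. -/
abbrev CoordRing (n : ℕ) : Type := MvPolynomial (Fin (n + 1)) ℂ

/-- Projective space `ℙⁿ` over `ℂ`, as the (Zariski) topological space underlying
`Proj ℂ[x₀, …, xₙ]`. -/
abbrev ProjSpace (n : ℕ) : Type :=
  ProjectiveSpectrum (MvPolynomial.homogeneousSubmodule (Fin (n + 1)) ℂ)

/-- The homogeneous ideal `I_X` of a subset `X` of `ℙⁿ`. -/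
noncomputable def idealOf {n : ℕ} (X : Set (ProjSpace n)) : Ideal (CoordRing n) :=
  (ProjectiveSpectrum.vanishingIdeal X).toIdeal

/-- `I` is generated by quadrics, that is, by homogeneous polynomials of degree two. -/
def GeneratedByQuadrics {n : ℕ} (I : Ideal (CoordRing n)) : Prop :=
  ∃ S : Set (CoordRing n), (∀ q ∈ S, q.IsHomogeneous 2) ∧ I = Ideal.span S

/-- `X` lies in a hyperplane, the zero locus of a nonzero linear form. -/
def ContainedInHyperplane {n : ℕ} (X : Set (ProjSpace n)) : Prop :=
  ∃ l : CoordRing n, l.IsHomogeneous 1 ∧ l ≠ 0 ∧ X ⊆ ProjectiveSpectrum.zeroLocus _ {l}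

/-- The degree `m` part of the graded free module `⨁ j, R(-deg j)`; here `R(-a)ₘ = Rₘ₋ₐ`, which is
zero for `m < a`. -/
noncomputable def gradedPiece {n b : ℕ} (deg : Fin b → ℕ) (m : ℕ) :
    Submodule ℂ (Fin b → CoordRing n) :=
  Submodule.pi Set.univ fun j =>
    if deg j ≤ m then MvPolynomial.homogeneousSubmodule (Fin (n + 1)) ℂ (m - deg j) else ⊥

/-- A minimal graded free resolution
`0 ⟵ I ⟵ ⨁ j, R(-deg 0 j) ⟵ ⨁ j, R(-deg 1 j) ⟵ ⋯` of the ideal `I` of `R = ℂ[x₀, …, xₙ]`. -/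
structure MinimalFreeResolution {n : ℕ} (I : Ideal (CoordRing n)) where
  /-- the rank of the `i`-th free module -/
  betti : ℕ → ℕ
  /-- the degrees of the basis elements of the `i`-th free module -/
  deg : ∀ i, Fin (betti i) → ℕ
  /-- the augmentation onto `I` -/
  aug : (Fin (betti 0) → CoordRing n) →ₗ[CoordRing n] CoordRing n
  /-- the differential from the `(i + 1)`-st to the `i`-th free module -/
  d : ∀ i, (Fin (betti (i + 1)) → CoordRing n) →ₗ[CoordRing n] (Fin (betti i) → CoordRing n)
  /-- the augmentation is homogeneous of degree zero -/
  aug_homogeneous : ∀ j, (aug (Pi.single j 1)).IsHomogeneous (deg 0 j)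
  /-- the differentials are homogeneous of degree zero -/
  d_homogeneous : ∀ i j, d i (Pi.single j 1) ∈ gradedPiece (deg i) (deg (i + 1) j)
  range_aug : LinearMap.range aug = I
  exact_zero : LinearMap.range (d 0) = LinearMap.ker aug
  exact_succ : ∀ i, LinearMap.range (d (i + 1)) = LinearMap.ker (d i)
  /-- minimality: the image of every differential lies in `(x₀, …, xₙ)` times its target -/
  minimal : ∀ i v k, MvPolynomial.constantCoeff (d i v k) = 0

namespace MinimalFreeResolution

variable {n : ℕ} {I : Ideal (CoordRing n)} (F : MinimalFreeResolution I)

/-- The space `Fᵢ` of `i`-th linear syzygies: the linear part `Fᵢ ⊗ R(-i-2)` of the `i`-th module of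
the resolution is the free summand on the basis elements of degree `i + 2`, and `Fᵢ` is the complex
vector space that these basis elements span. -/
noncomputable def linearSyzygies (i : ℕ) : Submodule ℂ (Fin (F.betti i) → CoordRing n) :=
  Submodule.span ℂ {v | ∃ j, F.deg i j = i + 2 ∧ v = Pi.single j 1}

/-- For `f ∈ F_{i+1}`, the subspaces `G ⊆ Fᵢ` for which the differential maps `f ⊗ R(-i-3)` into
(the image of) `G ⊗ R(-i-2)`. -/
def involving (i : ℕ) (f : Fin (F.betti (i + 1)) → CoordRing n) :
    Set (Submodule ℂ (Fin (F.betti i) → CoordRing n)) :=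
  {G | G ≤ F.linearSyzygies i ∧
    F.d i f ∈ Submodule.span (CoordRing n) (G : Set (Fin (F.betti i) → CoordRing n))}

/-- The space of `i`-th linear syzygies involved in the `(i + 1)`-st linear syzygy `f`: the smallest
`G ⊆ Fᵢ` such that the differential maps `f ⊗ R(-i-3)` into `G ⊗ R(-i-2)`. That the intersection is
indeed the smallest such space is `isLeast_involvedSpace`. -/
noncomputable def involvedSpace (i : ℕ) (f : Fin (F.betti (i + 1)) → CoordRing n) :
    Submodule ℂ (Fin (F.betti i) → CoordRing n) :=
  sInf (F.involving i f)

/-- The rank of the `(i + 1)`-st linear syzygy `f`. -/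
noncomputable def rank (i : ℕ) (f : Fin (F.betti (i + 1)) → CoordRing n) : ℕ :=
  Module.finrank ℂ (F.involvedSpace i f)

theorem isLeast_involvedSpace (i : ℕ) (f : Fin (F.betti (i + 1)) → CoordRing n)
    (hne : (F.involving i f).Nonempty) :
    IsLeast (F.involving i f) (F.involvedSpace i f) := by
  have hcoef : ∀ G ∈ F.involving i f, ∀ m : Fin (n + 1) →₀ ℕ,
      (fun j => MvPolynomial.C (MvPolynomial.coeff m (F.d i f j))) ∈ G := by
    rintro G ⟨hG, hmem⟩ m
    have hconst : ∀ g ∈ G, ∃ c : Fin (F.betti i) → ℂ, g = fun j => MvPolynomial.C (c j) := by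
      intro g hg
      have hg' := hG hg
      clear hg
      unfold linearSyzygies at hg'
      induction hg' using Submodule.span_induction with
      | mem x hx =>
        obtain ⟨j, -, rfl⟩ := hx
        refine ⟨Pi.single j 1, ?_⟩
        ext1 k
        by_cases hk : k = j
        · subst hk; simp
        · simp [hk]
      | zero => exact ⟨0, by ext1; simp⟩
      | add x y _ _ hx hy =>
        obtain ⟨c, hc⟩ := hx
        obtain ⟨e, he⟩ := hy
        exact ⟨c + e, by ext1; simp [hc, he]⟩
      | smul a x _ hx =>
        obtain ⟨c, hc⟩ := hx
        exact ⟨a • c, by ext1; simp [hc, MvPolynomial.smul_eq_C_mul]⟩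
    generalize F.d i f = w at hmem
    induction hmem using Submodule.span_induction generalizing m with
    | mem x hx =>
      obtain ⟨c, rfl⟩ := hconst x hx
      by_cases hm : m = 0
      · subst hm
        simpa using hx
      · have : (fun j => MvPolynomial.C (MvPolynomial.coeff m (MvPolynomial.C (c j)))) =
            (0 : Fin (F.betti i) → CoordRing n) := by
          ext1 j
          simp [MvPolynomial.coeff_C, Ne.symm hm]
        rw [this]
        exact G.zero_mem
    | zero =>
      convert G.zero_mem using 1
      ext1; simp
    | add x y _ _ hx hy =>
      convert G.add_mem (hx m) (hy m) using 1
      ext1; simp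
    | smul a x _ hx =>
      have : (fun j => MvPolynomial.C (MvPolynomial.coeff m ((a • x) j))) =
          ∑ q ∈ Finset.HasAntidiagonal.antidiagonal m, MvPolynomial.coeff q.1 a •
            (fun j => (MvPolynomial.C (MvPolynomial.coeff q.2 (x j)) : CoordRing n)) := by
        ext1 j
        simp [MvPolynomial.coeff_mul, MvPolynomial.smul_eq_C_mul]
      rw [this]
      exact G.sum_mem fun q _ => G.smul_mem _ (hx q.2)
  obtain ⟨G₀, hG₀⟩ := hne
  refine ⟨⟨(sInf_le hG₀).trans hG₀.1, ?_⟩, fun G hG => sInf_le hG⟩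
  have hrep : F.d i f = ∑ m ∈ Finset.univ.biUnion (fun j => (F.d i f j).support),
      (MvPolynomial.monomial m (1 : ℂ)) •
        (fun j => (MvPolynomial.C (MvPolynomial.coeff m (F.d i f j)) : CoordRing n)) := by
    ext1 j
    rw [Finset.sum_apply]
    conv_lhs => rw [MvPolynomial.as_sum (F.d i f j)]
    simp only [Pi.smul_apply, smul_eq_mul]
    refine (Finset.sum_subset (Finset.subset_biUnion_of_mem
      (fun j => (F.d i f j).support) (Finset.mem_univ j)) ?_).trans ?_
    · intro m _ hm
      simp [MvPolynomial.notMem_support_iff.mp hm]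
    · refine Finset.sum_congr rfl fun m _ => ?_
      rw [mul_comm, MvPolynomial.C_mul_monomial, mul_one]
  rw [hrep]
  refine Submodule.sum_mem _ fun m _ => Submodule.smul_mem _ _ (Submodule.subset_span ?_)
  exact (Submodule.mem_sInf).mpr fun G hG => hcoef G hG m

end MinimalFreeResolution

end LinearSyzygies

namespace LinearSyzygies

open MvPolynomial

attribute [local instance] MvPolynomial.gradedAlgebra

/-! ### Linear forms and the linear syzygies among them. -/

section LinearForms

variable {n : ℕ} {ι : Type*} [Fintype ι]

/-! Rank `p + 1` means that the differential of `f` is a combination `∑ l x • g x` with `m ≤ p + 1`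
independent linear forms `l x` and constant vectors `g x` of `(p - 1)`-st linear syzygies
(`exists_d_eq_sum`). The `g x` start a map from a Koszul complex on the `l x` to the linear strand.
Since `d ∘ d = 0`, the differentials of the current components satisfy `∑ l x * c x = 0` with linear
`c x`. Koszul exactness (`eq_sum_eval_dual`) expands `c x` in the `l y` with antisymmetric
coefficients, which are the components one step lower (`IsKoszulLift.exists_pred`). Minimality keeps
the map nonzero at every step.

At the bottom, a nonzero component is indexed by `p` distinct forms out of at most `p + 1`. The
Koszul relation then has only two terms, `l x * q x + l y * q y = 0`, so `l y` divides the nonzero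
quadric `q x ∈ I` (`IsKoszulLift.exists_mul_mem`). Both factors are linear, and an ideal generated
by quadrics contains no nonzero linear form, so `I` is not prime and `X` is not irreducible. -/

theorem eval_add_of_isHomogeneous_one {q : CoordRing n} (hq : q.IsHomogeneous 1)
    (u v : Fin (n + 1) → ℂ) : eval (u + v) q = eval u q + eval v q := by
  rw [← mem_homogeneousSubmodule, homogeneousSubmodule_one_eq_span_X] at hq
  induction hq using Submodule.span_induction with
  | mem x hx => obtain ⟨j, rfl⟩ := hx; simp
  | zero => simp
  | add x y _ _ hx hy => simp only [map_add, hx, hy]; ring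
  | smul a x _ hx => simp only [smul_eval, hx]; ring

theorem eval_smul_of_isHomogeneous_one {q : CoordRing n} (hq : q.IsHomogeneous 1)
    (a : ℂ) (u : Fin (n + 1) → ℂ) : eval (a • u) q = a * eval u q := by
  rw [← mem_homogeneousSubmodule, homogeneousSubmodule_one_eq_span_X] at hq
  induction hq using Submodule.span_induction with
  | mem x hx => obtain ⟨j, rfl⟩ := hx; simp
  | zero => simp
  | add x y _ _ hx hy => simp only [map_add, hx, hy]; ring
  | smul b x _ hx => simp only [smul_eval, hx]; ring

/-- Evaluation of a linear form, as a linear functional. -/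
noncomputable def evalLinear {q : CoordRing n} (hq : q.IsHomogeneous 1) :
    (Fin (n + 1) → ℂ) →ₗ[ℂ] ℂ where
  toFun u := eval u q
  map_add' := eval_add_of_isHomogeneous_one hq
  map_smul' a u := by simpa using eval_smul_of_isHomogeneous_one hq a u

/-- A functional killing the image of joint evaluation at the `l x` would be a linear relation among
them, so this evaluation is surjective. -/
theorem exists_dual_vectors [DecidableEq ι] {l : ι → CoordRing n}
    (hl : ∀ x, (l x).IsHomogeneous 1) (hli : LinearIndependent ℂ l) :
    ∃ v : ι → Fin (n + 1) → ℂ, ∀ x y, eval (v x) (l y) = if x = y then 1 else 0 := by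
  let T : (Fin (n + 1) → ℂ) →ₗ[ℂ] (ι → ℂ) := LinearMap.pi fun x => evalLinear (hl x)
  have hT : ∀ u x, T u x = eval u (l x) := fun _ _ => rfl
  have hsurj : LinearMap.range T = ⊤ := by
    by_contra hne
    obtain ⟨φ, hφ, hφT⟩ := Submodule.exists_dual_map_eq_bot_of_lt_top
      (lt_top_iff_ne_top.mpr hne) inferInstance
    have hsum : ∑ x, φ (Pi.single x 1) • l x = 0 := by
      refine MvPolynomial.funext fun u => ?_
      have h0 : φ (T u) = 0 := by
        have : φ (T u) ∈ (LinearMap.range T).map φ :=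
          Submodule.mem_map_of_mem (LinearMap.mem_range_self T u)
        rwa [hφT, Submodule.mem_bot] at this
      rw [LinearMap.pi_apply_eq_sum_univ φ (T u)] at h0
      simp only [map_sum, smul_eval, map_zero]
      rw [← h0]
      refine Finset.sum_congr rfl fun x _ => ?_
      rw [hT, smul_eq_mul, mul_comm]
      congr 2
      ext y
      simp [Pi.single_apply, eq_comm]
    have hz := Fintype.linearIndependent_iff.mp hli _ hsum
    apply hφ
    refine LinearMap.pi_ext' fun x => LinearMap.ext_ring ?_
    simpa using hz x
  choose v hv using fun x : ι => LinearMap.range_eq_top.mp hsurj (Pi.single x 1)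
  refine ⟨v, fun x y => ?_⟩
  rw [← hT, hv, Pi.single_apply]
  simp [eq_comm]

section Syzygy

variable {l c : ι → CoordRing n} (hl : ∀ x, (l x).IsHomogeneous 1)
  (hc : ∀ x, (c x).IsHomogeneous 1) (h : ∑ x, l x * c x = 0)

include hl hc h in
theorem sum_polarization (u v : Fin (n + 1) → ℂ) :
    ∑ x, (eval u (l x) * eval v (c x) + eval v (l x) * eval u (c x)) = 0 := by
  have key : ∀ w, ∑ x, eval w (l x) * eval w (c x) = 0 := fun w => by
    simpa using congrArg (eval w) h
  have h1 := key (u + v)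
  simp only [eval_add_of_isHomogeneous_one (hl _), eval_add_of_isHomogeneous_one (hc _)] at h1
  have h2 := key u
  have h3 := key v
  calc _ = ∑ x, ((eval u (l x) + eval v (l x)) * (eval u (c x) + eval v (c x))
        - eval u (l x) * eval u (c x) - eval v (l x) * eval v (c x)) :=
        Finset.sum_congr rfl fun x _ => by ring
    _ = 0 := by rw [Finset.sum_sub_distrib, Finset.sum_sub_distrib, h1, h2, h3]; simp

variable [DecidableEq ι] {v : ι → Fin (n + 1) → ℂ}
  (hv : ∀ x y, eval (v x) (l y) = if x = y then 1 else 0)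

include hl hc h hv in
theorem eval_dual_antisymm (x y : ι) : eval (v x) (c y) = -eval (v y) (c x) := by
  have := sum_polarization hl hc h (v x) (v y)
  simp only [hv, Finset.sum_add_distrib, ite_mul, one_mul, zero_mul, Finset.sum_ite_eq,
    Finset.mem_univ, if_true] at this
  linear_combination this

include hl hc h hv in
/-- Exactness of the Koszul complex of independent linear forms, in linear degree. -/
theorem eq_sum_eval_dual (x : ι) : c x = ∑ y, C (eval (v y) (c x)) * l y := by
  refine MvPolynomial.funext fun u => ?_
  -- `w` is the part of `u` on which every `l y` vanishes; polarizing against `v x` then gives `c x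
  -- = 0` at `w`.
  set w := u - ∑ y, eval u (l y) • v y with hw
  have hsumc : ∀ {q : CoordRing n}, q.IsHomogeneous 1 →
      eval (∑ y, eval u (l y) • v y) q = ∑ y, eval u (l y) * eval (v y) q := fun hq => by
    change evalLinear hq _ = _
    rw [map_sum]
    exact Finset.sum_congr rfl fun y _ => eval_smul_of_isHomogeneous_one hq _ _
  have hu : u = w + ∑ y, eval u (l y) • v y := by simp [hw]
  have hwl : ∀ y, eval w (l y) = 0 := fun y => by
    have := congrArg (fun t => eval t (l y)) hu
    simp only [eval_add_of_isHomogeneous_one (hl y), hsumc (hl y), hv] at this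
    simpa using this
  have hwc : eval w (c x) = 0 := by
    have := sum_polarization hl hc h (v x) w
    simpa [hv, hwl] using this
  have := congrArg (fun t => eval t (c x)) hu
  simp only [eval_add_of_isHomogeneous_one (hc x), hsumc (hc x), hwc, zero_add] at this
  rw [this]
  simp [mul_comm]

end Syzygy

theorem prime_of_isHomogeneous_one {q : CoordRing n} (hq : q.IsHomogeneous 1) (h0 : q ≠ 0) :
    Prime q := by
  refine UniqueFactorizationMonoid.irreducible_iff_prime.mp
    (irreducible_of_totalDegree_eq_one (hq.totalDegree h0) fun a ha => ?_)
  obtain ⟨m, hm⟩ := MvPolynomial.ne_zero_iff.mp h0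
  refine isUnit_iff_ne_zero.mpr ?_
  rintro rfl
  exact hm (by simpa using ha m)

theorem not_dvd_of_linearIndependent {l : ι → CoordRing n} (hl : ∀ x, (l x).IsHomogeneous 1)
    (hli : LinearIndependent ℂ l) {x y : ι} (hxy : x ≠ y) : ¬ l x ∣ l y := by
  classical
  rintro ⟨q, hq⟩
  obtain ⟨v, hv⟩ := exists_dual_vectors hl hli
  have := congrArg (eval (v y)) hq
  simp [hv, hxy.symm] at this

end LinearForms

/-! ### Vanishing ideals of irreducible sets, and ideals generated by quadrics. -/

section Ideals

variable {n : ℕ} {X : Set (ProjSpace n)}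

theorem mem_or_mem_of_isIrreducible (hX : IsIrreducible X) {a b : CoordRing n}
    (hab : a * b ∈ idealOf X) : a ∈ idealOf X ∨ b ∈ idealOf X := by
  have hmem : ∀ q : CoordRing n, q ∈ idealOf X ↔ X ⊆ ProjectiveSpectrum.zeroLocus _ {q} := by
    intro q
    rw [ProjectiveSpectrum.subset_zeroLocus_iff_subset_vanishingIdeal, Set.singleton_subset_iff]
    rfl
  rw [hmem, ProjectiveSpectrum.zeroLocus_singleton_mul] at hab
  rw [hmem, hmem]
  exact isPreirreducible_iff_isClosed_union_isClosed.mp hX.2 _ _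
    (ProjectiveSpectrum.isClosed_zeroLocus _ _) (ProjectiveSpectrum.isClosed_zeroLocus _ _) hab

theorem GeneratedByQuadrics.coeff_eq_zero {I : Ideal (CoordRing n)}
    (hI : GeneratedByQuadrics I) {q : CoordRing n} (hq : q ∈ I) {m : Fin (n + 1) →₀ ℕ}
    (hm : m.degree < 2) : coeff m q = 0 := by
  obtain ⟨S, hS, rfl⟩ := hI
  induction hq using Submodule.span_induction generalizing m with
  | mem x hx => exact (hS x hx).coeff_eq_zero hm.ne
  | zero => simp
  | add x y _ _ hx hy => rw [coeff_add, hx hm, hy hm, add_zero]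
  | smul a x _ hx =>
    classical
    rw [smul_eq_mul, coeff_mul]
    refine Finset.sum_eq_zero fun t ht => ?_
    rw [Finset.HasAntidiagonal.mem_antidiagonal] at ht
    rw [hx (by rw [← ht, map_add] at hm; omega), mul_zero]

theorem GeneratedByQuadrics.eq_zero_of_totalDegree_lt {I : Ideal (CoordRing n)}
    (hI : GeneratedByQuadrics I) {q : CoordRing n} (hq : q ∈ I) (hdeg : q.totalDegree < 2) :
    q = 0 := by
  ext m
  by_cases hm : m.degree < 2
  · simpa using hI.coeff_eq_zero hq hm
  · simpa using coeff_eq_zero_of_totalDegree_lt (f := q) (d := m)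
      (by rw [← Finsupp.degree_apply]; omega)

end Ideals

/-- A vector of complex numbers, as a vector of constant polynomials. -/
noncomputable def constVec {n b : ℕ} (c : Fin b → ℂ) : Fin b → CoordRing n := fun j => C (c j)

theorem constVec_eq_sum {n b : ℕ} (c : Fin b → ℂ) :
    (constVec c : Fin b → CoordRing n) = ∑ j, c j • Pi.single j 1 := by
  ext1 k
  simp [constVec, Finset.sum_apply, Pi.single_apply, smul_eq_C_mul]

theorem mem_gradedPiece {n b : ℕ} {deg : Fin b → ℕ} {m : ℕ} {w : Fin b → CoordRing n} :
    w ∈ gradedPiece deg m ↔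
      ∀ j, (deg j ≤ m → (w j).IsHomogeneous (m - deg j)) ∧ (m < deg j → w j = 0) := by
  simp only [gradedPiece, Submodule.mem_pi, Set.mem_univ, true_imp_iff]
  refine forall_congr' fun j => ?_
  split_ifs with h
  · simp [h, not_lt.mpr h]
  · simp [h, not_le.mp h]

/-! ### The linear strand of a minimal resolution. -/

namespace MinimalFreeResolution

variable {n : ℕ} {I : Ideal (CoordRing n)} (F : MinimalFreeResolution I)

/-- Minimality: vectors in the image have zero constant terms. With exactness, this makes the
differential and the augmentation injective on constant vectors. -/
theorem eq_zero_of_constVec_mem_range {k : ℕ} {φ : Fin (F.betti k) → ℂ}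
    (h : constVec φ ∈ LinearMap.range (F.d k)) : φ = 0 := by
  obtain ⟨w, hw⟩ := h
  ext j
  simpa [hw, constVec] using F.minimal k w j

theorem eq_zero_of_d_constVec {k : ℕ} {φ : Fin (F.betti (k + 1)) → ℂ}
    (h : F.d k (constVec φ) = 0) : φ = 0 :=
  F.eq_zero_of_constVec_mem_range (by rw [F.exact_succ]; exact h)

theorem eq_zero_of_aug_constVec {φ : Fin (F.betti 0) → ℂ}
    (h : F.aug (constVec φ) = 0) : φ = 0 :=
  F.eq_zero_of_constVec_mem_range (by rw [F.exact_zero]; exact h)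

theorem constVec_single {b : ℕ} (j : Fin b) :
    (constVec (Pi.single j 1) : Fin b → CoordRing n) = Pi.single j 1 := by
  ext1 k
  by_cases h : k = j
  · subst h; simp [constVec]
  · simp [constVec, h]

/-- Degrees grow strictly along a minimal resolution: a generator of too small degree would have
only constant entries in its differential, hence differential zero. -/
theorem add_two_le_deg (hI : GeneratedByQuadrics I) (k : ℕ) (j : Fin (F.betti k)) :
    k + 2 ≤ F.deg k j := by
  induction k with
  | zero =>
    by_contra hlt
    refine (Pi.single_ne_zero_iff.mpr one_ne_zero : (Pi.single j 1 : Fin _ → ℂ) ≠ 0) (F.eq_zero_of_aug_constVec ?_)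
    rw [constVec_single]
    refine hI.eq_zero_of_totalDegree_lt ?_
      ((F.aug_homogeneous j).totalDegree_le.trans_lt (by omega))
    have := LinearMap.mem_range_self F.aug (Pi.single j 1)
    rwa [F.range_aug] at this
  | succ k ih =>
    by_contra hlt
    refine (Pi.single_ne_zero_iff.mpr one_ne_zero : (Pi.single j 1 : Fin _ → ℂ) ≠ 0) (F.eq_zero_of_d_constVec ?_)
    rw [constVec_single]
    ext1 t
    have ht := mem_gradedPiece.mp (F.d_homogeneous k j) t
    have := ih t
    by_cases hle : F.deg k t ≤ F.deg (k + 1) j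
    · have h0 := ht.1 hle
      rw [show F.deg (k + 1) j - F.deg k t = 0 by omega,
        ← totalDegree_zero_iff_isHomogeneous, totalDegree_eq_zero_iff_eq_C] at h0
      have hm := F.minimal k (Pi.single j 1) t
      rw [constantCoeff_eq] at hm
      rw [h0, hm]
      simp
    · exact ht.2 (by omega)

theorem d_constVec_mem_gradedPiece {k m : ℕ} {φ : Fin (F.betti (k + 1)) → ℂ}
    (hφ : ∀ j, F.deg (k + 1) j ≠ m → φ j = 0) :
    F.d k (constVec φ) ∈ gradedPiece (F.deg k) m := by
  rw [constVec_eq_sum, map_sum]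
  refine Submodule.sum_mem _ fun j _ => ?_
  rw [LinearMap.map_smul_of_tower]
  by_cases hj : F.deg (k + 1) j = m
  · exact Submodule.smul_mem _ _ (hj ▸ F.d_homogeneous k j)
  · rw [hφ j hj, zero_smul]
    exact Submodule.zero_mem _

theorem d_constVec_eq_zero (hI : GeneratedByQuadrics I) {k : ℕ} {φ : Fin (F.betti (k + 1)) → ℂ}
    (hφ : ∀ j, F.deg (k + 1) j ≠ k + 3 → φ j = 0) {j : Fin (F.betti k)}
    (hj : F.deg k j ≠ k + 2) : F.d k (constVec φ) j = 0 := by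
  have hd := mem_gradedPiece.mp (F.d_constVec_mem_gradedPiece hφ) j
  have hge := F.add_two_le_deg hI k j
  by_cases hle : F.deg k j ≤ k + 3
  · have h0 := hd.1 hle
    rw [show k + 3 - F.deg k j = 0 by omega,
      ← totalDegree_zero_iff_isHomogeneous, totalDegree_eq_zero_iff_eq_C] at h0
    have hm := F.minimal k (constVec φ) j
    rw [constantCoeff_eq] at hm
    rw [h0, hm]
    simp
  · exact hd.2 (by omega)

theorem d_constVec_isHomogeneous (hI : GeneratedByQuadrics I) {k : ℕ}
    {φ : Fin (F.betti (k + 1)) → ℂ} (hφ : ∀ j, F.deg (k + 1) j ≠ k + 3 → φ j = 0)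
    (j : Fin (F.betti k)) : (F.d k (constVec φ) j).IsHomogeneous 1 := by
  by_cases hj : F.deg k j = k + 2
  · have := (mem_gradedPiece.mp (F.d_constVec_mem_gradedPiece hφ) j).1 (by omega)
    rwa [show k + 3 - F.deg k j = 1 by omega] at this
  · rw [F.d_constVec_eq_zero hI hφ hj]
    exact isHomogeneous_zero _ _ _

theorem aug_constVec_isHomogeneous {φ : Fin (F.betti 0) → ℂ}
    (hφ : ∀ j, F.deg 0 j ≠ 2 → φ j = 0) : (F.aug (constVec φ)).IsHomogeneous 2 := by
  rw [constVec_eq_sum, map_sum]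
  refine IsHomogeneous.sum _ _ _ fun j _ => ?_
  rw [LinearMap.map_smul_of_tower, smul_eq_C_mul]
  by_cases hj : F.deg 0 j = 2
  · exact (hj ▸ F.aug_homogeneous j).C_mul _
  · rw [hφ j hj, C_0, zero_mul]
    exact isHomogeneous_zero _ _ _

theorem exists_eq_constVec {k : ℕ} {w : Fin (F.betti k) → CoordRing n}
    (hw : w ∈ F.linearSyzygies k) :
    ∃ φ : Fin (F.betti k) → ℂ, w = constVec φ ∧ ∀ j, F.deg k j ≠ k + 2 → φ j = 0 := by
  unfold linearSyzygies at hw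
  induction hw using Submodule.span_induction with
  | mem x hx =>
    obtain ⟨j, hj, rfl⟩ := hx
    refine ⟨Pi.single j 1, (constVec_single j).symm, fun t ht => ?_⟩
    rw [Pi.single_eq_of_ne]
    rintro rfl
    exact ht hj
  | zero => exact ⟨0, by ext1; simp [constVec], fun _ _ => rfl⟩
  | add x y _ _ hx hy =>
    obtain ⟨c, rfl, hc⟩ := hx
    obtain ⟨e, rfl, he⟩ := hy
    exact ⟨c + e, by ext1; simp [constVec], fun j hj => by simp [hc j hj, he j hj]⟩
  | smul a x _ hx =>
    obtain ⟨c, rfl, hc⟩ := hx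
    exact ⟨a • c, by ext1; simp [constVec, smul_eq_C_mul], fun j hj => by simp [hc j hj]⟩

/-- Components of a map from the dual of the Koszul complex on the linear forms `l` to the linear
strand of `F`: `ψ` sends a wedge product of `N + 1` basis vectors, given as a list, to a `k`-th
linear syzygy. -/
structure IsKoszulLift {ι : Type*} [Fintype ι] (l : ι → CoordRing n) (k N : ℕ)
    (ψ : List ι → Fin (F.betti k) → ℂ) : Prop where
  apply_eq_zero : ∀ ω j, F.deg k j ≠ k + 2 → ψ ω j = 0
  sum_mem_range : ∀ ω, ω.length = N →
    ∑ x, l x • constVec (ψ (x :: ω)) ∈ LinearMap.range (F.d k)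
  eq_zero_of_not_nodup : ∀ ω, ω.length = N + 1 → ¬ ω.Nodup → ψ ω = 0
  exists_ne_zero : ∃ ω, ω.length = N + 1 ∧ ψ ω ≠ 0

/-! ### Descending the Koszul lift to the quadrics. -/

section Koszul

variable {ι : Type*} [Fintype ι] {l : ι → CoordRing n} {F}

theorem IsKoszulLift.exists_pred (hI : GeneratedByQuadrics I) (hl : ∀ x, (l x).IsHomogeneous 1)
    (hli : LinearIndependent ℂ l) {k N : ℕ} {ψ : List ι → Fin (F.betti (k + 1)) → ℂ}
    (h : F.IsKoszulLift l (k + 1) N ψ) : ∃ ψ', F.IsKoszulLift l k (N + 1) ψ' := by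
  classical
  obtain ⟨v, hv⟩ := exists_dual_vectors hl hli
  have hhom := fun ω j => F.d_constVec_isHomogeneous hI (h.apply_eq_zero ω) j
  have hsum : ∀ ω, ω.length = N → ∀ j, ∑ x, l x * F.d k (constVec (ψ (x :: ω))) j = 0 := by
    intro ω hω j
    have := h.sum_mem_range ω hω
    rw [F.exact_succ, LinearMap.mem_ker, map_sum] at this
    simpa using congrFun this j
  -- The value at `m :: ω` is the coefficient of `l m` in the differential of `ψ ω`; the value at
  -- `[]` is never used as a component.
  let ψ' : List ι → Fin (F.betti k) → ℂ
    | [] => 0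
    | m :: ω => fun j => eval (v m) (F.d k (constVec (ψ ω)) j)
  have hanti : ∀ x m ω, ω.length = N → ψ' (m :: x :: ω) = -ψ' (x :: m :: ω) := by
    intro x m ω hω
    ext j
    exact eval_dual_antisymm hl (fun x => hhom (x :: ω) j) (hsum ω hω j) hv m x
  have hzero : ∀ m ω, ψ ω = 0 → ψ' (m :: ω) = 0 := by
    intro m ω hω
    have h0 : (constVec (0 : Fin (F.betti (k + 1)) → ℂ) : _ → CoordRing n) = 0 := by
      ext1; simp [constVec]
    ext j
    simp [ψ', hω, h0]
  have hd : ∀ ω, ω.length = N + 1 →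
      ∑ x, l x • constVec (ψ' (x :: ω)) = F.d k (constVec (ψ ω)) := by
    intro ω hω
    obtain ⟨x, ω, rfl⟩ := List.exists_cons_of_length_eq_add_one hω
    ext1 j
    rw [eq_sum_eval_dual hl (fun x => hhom (x :: ω) j) (hsum ω (by simpa using hω) j) hv x]
    simp [Finset.sum_apply, constVec, ψ', mul_comm]
  refine ⟨ψ', ⟨?_, ?_, ?_, ?_⟩⟩
  · rintro (_ | ⟨m, ω⟩) j hj
    · rfl
    · simp [ψ', F.d_constVec_eq_zero hI (h.apply_eq_zero ω) hj]
  · intro ω hω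
    rw [hd ω hω]
    exact LinearMap.mem_range_self _ _
  -- Antisymmetry in the first two entries suffices: a repetition within the tail is already killed
  -- by `ψ`, `m = x` is killed by antisymmetry, and if `m` recurs later, the swap moves the
  -- repetition into the tail.
  · intro ω hω hnd
    obtain ⟨m, x, ω, rfl⟩ : ∃ m x ω', ω = m :: x :: ω' := by
      match ω, hω with
      | m :: x :: ω', _ => exact ⟨m, x, ω', rfl⟩
    have hlen : ω.length = N := by simpa using hω
    by_cases h1 : (x :: ω).Nodup
    · rw [hanti x m ω hlen]
      by_cases hmx : m = x
      · subst hmx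
        have := hanti m m ω hlen
        rw [neg_eq_zero]
        ext j
        exact self_eq_neg.mp (congrFun this j)
      · rw [hzero, neg_zero]
        refine h.eq_zero_of_not_nodup _ (by simpa using hlen) fun h2 => hnd ?_
        rw [List.nodup_cons] at h2 ⊢
        exact ⟨by simp [hmx, h2.1], h1⟩
    · exact hzero _ _ (h.eq_zero_of_not_nodup _ (by simpa using hlen) h1)
  · obtain ⟨ω, hω, hne⟩ := h.exists_ne_zero
    by_contra! hall
    refine hne (F.eq_zero_of_d_constVec ?_)
    rw [← hd ω hω]
    refine Finset.sum_eq_zero fun x _ => ?_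
    rw [hall (x :: ω) (by simpa using hω)]
    ext1; simp [constVec]

theorem IsKoszulLift.exists_zero (hI : GeneratedByQuadrics I) (hl : ∀ x, (l x).IsHomogeneous 1)
    (hli : LinearIndependent ℂ l) {k N : ℕ} {ψ : List ι → Fin (F.betti k) → ℂ}
    (h : F.IsKoszulLift l k N ψ) : ∃ ψ', F.IsKoszulLift l 0 (N + k) ψ' := by
  induction k generalizing N with
  | zero => exact ⟨ψ, h⟩
  | succ k ih =>
    obtain ⟨ψ', h'⟩ := h.exists_pred hI hl hli
    obtain ⟨ψ'', h''⟩ := ih h'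
    exact ⟨ψ'', by rwa [show N + (k + 1) = N + 1 + k by ring]⟩

/-- The quadrics of a top-dimensional Koszul lift are reducible, whence `I` is not prime. -/
theorem IsKoszulLift.exists_mul_mem (hI : GeneratedByQuadrics I)
    (hl : ∀ x, (l x).IsHomogeneous 1) (hli : LinearIndependent ℂ l) {N : ℕ}
    (hcard : Fintype.card ι ≤ N + 2) {ψ : List ι → Fin (F.betti 0) → ℂ}
    (h : F.IsKoszulLift l 0 N ψ) : ∃ a b : CoordRing n, a * b ∈ I ∧ a ∉ I ∧ b ∉ I := by
  classical
  obtain ⟨ω, hω, hne⟩ := h.exists_ne_zero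
  have hnd : ω.Nodup := by
    by_contra hnd
    exact hne (h.eq_zero_of_not_nodup ω hω hnd)
  obtain ⟨x, τ, rfl⟩ := List.exists_cons_of_length_eq_add_one hω
  have hτ : τ.length = N := by simpa using hω
  rw [List.nodup_cons] at hnd
  set q : ι → CoordRing n := fun y => F.aug (constVec (ψ (y :: τ))) with hq
  have hq0 : q x ≠ 0 := fun h0 => hne (F.eq_zero_of_aug_constVec h0)
  have hqI : q x ∈ I := by
    rw [← F.range_aug]
    exact LinearMap.mem_range_self _ _
  have hsum : ∑ y, l y * q y = 0 := by
    have := h.sum_mem_range τ hτ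
    rw [F.exact_zero, LinearMap.mem_ker, map_sum] at this
    simpa using this
  have hqτ : ∀ y ∈ τ, q y = 0 := by
    intro y hy
    have h0 : (constVec (0 : Fin (F.betti 0) → ℂ) : _ → CoordRing n) = 0 := by
      ext1; simp [constVec]
    simp only [hq]
    rw [h.eq_zero_of_not_nodup (y :: τ) (by simpa using hτ) (by simp [hy]), h0, map_zero]
  -- At most one index lies outside `x :: τ`; if there were none, the relation would reduce to `l x
  -- * q x = 0`.
  obtain ⟨y, hyx, hy⟩ : ∃ y, y ≠ x ∧ ∀ z, z ≠ x → z ≠ y → z ∈ τ := by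
    have hcardc : (insert x τ.toFinset)ᶜ.card ≤ 1 := by
      rw [Finset.card_compl, Finset.card_insert_of_notMem (by simpa using hnd.1),
        List.toFinset_card_of_nodup hnd.2]
      omega
    obtain hemp | ⟨y, hy⟩ := (insert x τ.toFinset)ᶜ.eq_empty_or_nonempty
    · exfalso
      rw [Finset.sum_eq_single x] at hsum
      · exact (mul_ne_zero (hli.ne_zero x) hq0) hsum
      · intro z _ hz
        have : z ∈ insert x τ.toFinset := by
          by_contra hz'
          exact Finset.notMem_empty z (hemp ▸ Finset.mem_compl.mpr hz')
        rw [hqτ z (by simpa [hz] using this), mul_zero]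
      · simp
    · refine ⟨y, by rintro rfl; simp at hy, fun z hzx hzy => ?_⟩
      by_contra hz
      exact hzy (Finset.card_le_one.mp hcardc z (by simp [hzx, hz]) y hy)
  rw [← Finset.sum_subset (Finset.subset_univ {x, y}) (fun z _ hz => by
    rw [Finset.mem_insert, Finset.mem_singleton, not_or] at hz
    rw [hqτ z (hy z hz.1 hz.2), mul_zero]), Finset.sum_pair hyx.symm] at hsum
  have hdvd : l y ∣ l x * q x := ⟨-q y, by linear_combination hsum⟩
  obtain ⟨m, hm⟩ := ((prime_of_isHomogeneous_one (hl y) (hli.ne_zero y)).dvd_or_dvd hdvd).resolve_left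
    (not_dvd_of_linearIndependent hl hli hyx)
  have hm0 : m ≠ 0 := by rintro rfl; exact hq0 (by simpa using hm)
  have hly := (hl y).totalDegree (hli.ne_zero y)
  have hdeg := totalDegree_mul_of_isDomain (hli.ne_zero y) hm0
  rw [← hm, (F.aug_constVec_isHomogeneous (h.apply_eq_zero (x :: τ))).totalDegree hq0, hly] at hdeg
  exact ⟨l y, m, hm ▸ hqI,
    fun hmem => hli.ne_zero y (hI.eq_zero_of_totalDegree_lt hmem (by omega)),
    fun hmem => hm0 (hI.eq_zero_of_totalDegree_lt hmem (by omega))⟩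

end Koszul

/-! ### From the rank to the initial Koszul lift. -/

theorem involving_nonempty_of_rank_ne_zero {i : ℕ} {f : Fin (F.betti (i + 1)) → CoordRing n}
    (h : F.rank i f ≠ 0) : (F.involving i f).Nonempty := by
  by_contra hemp
  rw [Set.not_nonempty_iff_eq_empty] at hemp
  apply h
  -- An empty infimum is `⊤`, whose `finrank` is `0`: the space is either trivial or
  -- infinite-dimensional.
  rw [rank, involvedSpace, hemp, sInf_empty, finrank_top]
  rcases isEmpty_or_nonempty (Fin (F.betti i)) with _ | ⟨⟨j⟩⟩
  · exact Module.finrank_zero_of_subsingleton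
  · refine Module.finrank_of_not_finite fun hfin => ?_
    have : Module.Finite ℂ (CoordRing n) :=
      Module.Finite.of_surjective (LinearMap.proj (R := ℂ) (φ := fun _ => CoordRing n) j)
        (LinearMap.proj_surjective j)
    exact absurd (Module.Finite.finite_basis (MvPolynomial.basisMonomials (Fin (n + 1)) ℂ))
      (not_finite_iff_infinite.mpr inferInstance)

theorem ne_zero_of_rank_ne_zero {i : ℕ} {f : Fin (F.betti (i + 1)) → CoordRing n}
    (h : F.rank i f ≠ 0) : f ≠ 0 := by
  rintro rfl
  apply h
  rw [rank, involvedSpace, show sInf (F.involving i 0) = ⊥ from ?_, finrank_bot]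
  exact le_bot_iff.mp (sInf_le ⟨bot_le, by simp⟩)

/-- The differential of a syzygy of rank `r` involves at most `r` independent linear forms. -/
theorem exists_d_eq_sum (hI : GeneratedByQuadrics I) {i : ℕ}
    {φ : Fin (F.betti (i + 1)) → ℂ} (hφ : ∀ j, F.deg (i + 1) j ≠ i + 3 → φ j = 0)
    (hr : F.rank i (constVec φ) ≠ 0) :
    ∃ (m : ℕ) (l : Fin m → CoordRing n) (g : Fin m → Fin (F.betti i) → ℂ),
      m ≤ F.rank i (constVec φ) ∧ (∀ x, (l x).IsHomogeneous 1) ∧ LinearIndependent ℂ l ∧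
      (∀ x j, F.deg i j ≠ i + 2 → g x j = 0) ∧
      F.d i (constVec φ) = ∑ x, l x • constVec (g x) := by
  obtain ⟨hle, hmem⟩ := (F.isLeast_involvedSpace i _ (F.involving_nonempty_of_rank_ne_zero hr)).1
  have : FiniteDimensional ℂ (F.involvedSpace i (constVec φ)) :=
    Module.finite_of_finrank_pos (Nat.pos_of_ne_zero hr)
  let β := Module.finBasis ℂ (F.involvedSpace i (constVec φ))
  choose γ hγ hγ0 using fun x => F.exists_eq_constVec (hle (β x).2)
  obtain ⟨r, hrsum⟩ : ∃ r : Fin _ → CoordRing n,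
      ∑ x, r x • (β x : Fin (F.betti i) → CoordRing n) = F.d i (constVec φ) := by
    rw [← Submodule.mem_span_range_iff_exists_fun]
    refine (Submodule.span_le.mpr fun w hw => ?_) hmem
    have hrepr := congrArg Subtype.val (β.sum_repr ⟨w, hw⟩)
    rw [← show _ = w from hrepr, Submodule.coe_sum]
    exact Submodule.sum_mem _ fun x _ =>
      Submodule.smul_of_tower_mem _ _ (Submodule.subset_span ⟨x, rfl⟩)
  -- The coefficients `r x` need not be linear, but the differential is, so only their degree-one
  -- components contribute.
  have hlin : F.d i (constVec φ) = ∑ x, homogeneousComponent 1 (r x) • constVec (γ x) := by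
    ext1 j
    rw [← homogeneousComponent_eq_self (F.d_constVec_isHomogeneous hI hφ j), ← hrsum]
    simp only [hγ, Finset.sum_apply, map_sum, Pi.smul_apply, smul_eq_mul, constVec]
    refine Finset.sum_congr rfl fun x _ => ?_
    rw [mul_comm, homogeneousComponent_C_mul, mul_comm]
  let s : Fin _ → CoordRing n := fun x => homogeneousComponent 1 (r x)
  let V : Submodule ℂ (CoordRing n) := Submodule.span ℂ (Set.range s)
  have : FiniteDimensional ℂ V := FiniteDimensional.span_of_finite ℂ (Set.finite_range s)
  have hV1 : V ≤ homogeneousSubmodule (Fin (n + 1)) ℂ 1 := by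
    refine Submodule.span_le.mpr ?_
    rintro _ ⟨x, rfl⟩
    exact homogeneousComponent_isHomogeneous _ _
  let B := Module.finBasis ℂ V
  let s' : Fin _ → V := fun x => ⟨s x, Submodule.subset_span ⟨x, rfl⟩⟩
  have hs : ∀ x, s x = ∑ y, B.repr (s' x) y • (B y : CoordRing n) := fun x => by
    have := congrArg V.subtype (B.sum_repr (s' x))
    rw [map_sum] at this
    exact this.symm
  -- The linear coefficients may be dependent; regrouping along a basis of their span makes them
  -- independent without increasing their number.
  refine ⟨_, fun y => B y, fun y => ∑ x, B.repr (s' x) y • γ x, ?_, fun y => hV1 (B y).2,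
    B.linearIndependent.map' V.subtype V.ker_subtype, fun y j hj => ?_, ?_⟩
  · exact (finrank_range_le_card s).trans_eq (Fintype.card_fin _)
  · simp [Finset.sum_apply, hγ0 _ j hj]
  · rw [hlin]
    ext1 j
    change (∑ x, s x • constVec (γ x)) j = _
    simp only [Finset.sum_apply, Pi.smul_apply, constVec, smul_eq_mul, map_sum, C_mul,
      Finset.mul_sum]
    rw [Finset.sum_comm]
    refine Finset.sum_congr rfl fun x _ => ?_
    rw [hs x, Finset.sum_mul]
    refine Finset.sum_congr rfl fun y _ => ?_
    rw [smul_eq_C_mul]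
    ring

theorem exists_mul_mem_of_rank_le (hI : GeneratedByQuadrics I) {i : ℕ}
    {f : Fin (F.betti (i + 1)) → CoordRing n} (hf : f ∈ F.linearSyzygies (i + 1))
    (h0 : F.rank i f ≠ 0) (hrank : F.rank i f ≤ i + 2) :
    ∃ a b : CoordRing n, a * b ∈ I ∧ a ∉ I ∧ b ∉ I := by
  obtain ⟨φ, rfl, hφ⟩ := F.exists_eq_constVec hf
  obtain ⟨m, l, g, hm, hl, hli, hg, hd⟩ := F.exists_d_eq_sum hI hφ h0
  let ψ : List (Fin m) → Fin (F.betti i) → ℂ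
    | [] => 0
    | x :: _ => g x
  have hψ : F.IsKoszulLift l i 0 ψ := by
    refine ⟨?_, fun ω _ => ⟨constVec φ, hd⟩, fun ω hω hnd => ?_, ?_⟩
    · rintro (_ | ⟨x, ω⟩) j hj
      · rfl
      · exact hg x j hj
    · obtain ⟨x, rfl⟩ := List.length_eq_one_iff.mp hω
      exact absurd (List.nodup_singleton x) hnd
    · by_contra! hall
      apply F.ne_zero_of_rank_ne_zero h0
      have : φ = 0 := F.eq_zero_of_d_constVec (by
        rw [hd]
        refine Finset.sum_eq_zero fun x _ => ?_
        rw [show g x = 0 from hall [x] rfl]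
        ext1; simp [constVec])
      rw [this]
      ext1; simp [constVec]
  obtain ⟨ψ', hψ'⟩ := hψ.exists_zero hI hl hli
  -- After `i` descents `N = i`, so the bound `m ≤ i + 2` is exactly what is required.
  exact hψ'.exists_mul_mem hI hl hli (by rw [Fintype.card_fin]; omega)

end MinimalFreeResolution

end LinearSyzygies

/-- With `p = i + 1 ≥ 1`: a `p`-th linear syzygy of rank `p + 1` of the ideal of a projective
variety `X`, generated by quadrics, forces `X` to be contained in a hyperplane or reducible. -/
theorem corollary4p2 (n : ℕ) (X : Set (LinearSyzygies.ProjSpace n)) (hX : IsClosed X)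
    (hquad : LinearSyzygies.GeneratedByQuadrics (LinearSyzygies.idealOf X))
    (F : LinearSyzygies.MinimalFreeResolution (LinearSyzygies.idealOf X))
    (p i : ℕ) (hp : p = i + 1)
    (f : Fin (F.betti (i + 1)) → LinearSyzygies.CoordRing n)
    (hf : f ∈ F.linearSyzygies (i + 1))
    (hrank : F.rank i f = p + 1) :
    LinearSyzygies.ContainedInHyperplane X ∨ ¬ IsIrreducible X := by
  refine Or.inr fun hirr => ?_
  obtain ⟨a, b, hab, ha, hb⟩ :=
    F.exists_mul_mem_of_rank_le hquad hf (by omega) (by omega)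
  exact (LinearSyzygies.mem_or_mem_of_isIrreducible hirr hab).elim ha hb
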